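/- Let $M$ be a smooth manifold of dimension $2n$ (Hausdorff, paracompact, without boundary), let $\mathfrak X$ be the space of smooth vector fields on $M$, and let $\nabla$ be a smooth linear connection on $TM$ (torsion is allowed). For a smooth almost complex structure $j$ on $M$, that is, a smooth section $j$ of $\mathrm{End}(TM)$ with $j^2=-1$, let $\mathfrak X^{+,j}=\{Z\in\mathfrak X\otimes_{\mathbb R}\mathbb C : jZ=\sqrt{-1}\,Z\}$ be the space of complex vector fields of type $(1,0)$. Extend $\nabla$ complex bilinearly. One says that condition $A(j,j_1)$ holds if $\nabla_ZW\in\mathfrak X^{+,j_1}$ for all $Z\in\mathfrak X^{+,j}$ and $W\in\mathfrak X^{+,j_1}$, and that $j$ is self-holomorphic if condition $A(j,j)$ holds. A diffeomorphism $g$ of $M$ acts on vector fields by $(g\cdot X)_x=\mathrm dg(X_{g^{-1}(x)})$, on connections by $(g\cdot\nabla)_XY=g\cdot(\nabla_{g^{-1}\cdot X}(g^{-1}\cdot Y))$, and on almost complex structures by $j\mapsto \mathrm dg\,j\,\mathrm dg^{-1}$. Let $\mathrm{Diff}(M,\nabla)=\{g\in\mathrm{Diff}(M): g\cdot\nabla=\nabla\}$.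 (1) If $j$ is self-holomorphic and $g$ is a diffeomorphism of $M$ with $g\cdot\nabla=\nabla$, then $\tilde j=\mathrm dg\,j\,\mathrm dg^{-1}$ is self-holomorphic. (2) Consequently the moduli space $$\mathcal M^\nabla=\{j : j \text{ is a self-holomorphic almost complex structure on } M\}/\mathrm{Diff}(M,\nabla)$$ is well defined: the formula $g\cdot j=\mathrm dg\,j\,\mathrm dg^{-1}$ defines an action of the group $\mathrm{Diff}(M,\nabla)$ on the set of self-holomorphic almost complex structures, and two such structures define the same point of $\mathcal M^\nabla$ if and only if some element of $\mathrm{Diff}(M,\nabla)$ carries one to the other. -/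

import Mathlib

open scoped Manifold ContDiff Bundle TensorProduct

noncomputable section

namespace SelfHol

/-! ### The group of diffeomorphisms -/

section Diffeos

variable {E : Type*} [NormedAddCommGroup E] [NormedSpace ℝ E]
  {H : Type*} [TopologicalSpace H] {I : ModelWithCorners ℝ E H}
  {M : Type*} [TopologicalSpace M] [ChartedSpace H M]

/-- `Diff(M)` is a group under composition: `(g * h) x = g (h x)`. -/
instance diffeoGroup : Group (M ≃ₘ⟮I, I⟯ M) where
  mul g h := h.trans g
  one := Diffeomorph.refl I M ∞
  inv g := g.symm
  mul_assoc _ _ _ := rfl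
  one_mul _ := rfl
  mul_one _ := rfl
  inv_mul_cancel g := g.self_trans_symm

theorem mul_apply (g h : M ≃ₘ⟮I, I⟯ M) (x : M) : (g * h) x = g (h x) := rfl

theorem one_apply (x : M) : (1 : M ≃ₘ⟮I, I⟯ M) x = x := rfl

theorem inv_eq_symm (g : M ≃ₘ⟮I, I⟯ M) : g⁻¹ = g.symm := rfl

end Diffeos

section Fields

variable {E : Type*} [NormedAddCommGroup E] [NormedSpace ℝ E]
  {H : Type*} [TopologicalSpace H] (I : ModelWithCorners ℝ E H)
  (M : Type*) [TopologicalSpace M] [ChartedSpace H M] [IsManifold I ∞ M]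

/-- `𝔛`: the real vector space of smooth vector fields on `M`. -/
abbrev VectorFields := Cₛ^∞⟮I; E, (TangentSpace I : M → Type _)⟯

/-- The complex vector space of smooth complex vector fields, that is, of smooth sections of the
complexified tangent bundle. The pure tensor `1 ⊗ₜ X + Complex.I ⊗ₜ Y` is the field `X + iY`. -/
abbrev ComplexVectorFields := ℂ ⊗[ℝ] VectorFields I M

/-- An almost complex structure on `M`: a smooth section `j` of `End(TM)` with `j² = -1`. -/
@[ext]
structure AlmostComplexStructure where
  /-- The complex structure on each tangent space. -/
  toFun : ∀ x : M, TangentSpace I x →L[ℝ] TangentSpace I x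
  sq : ∀ (x : M) (v : TangentSpace I x), toFun x (toFun x v) = -v
  smooth : ContMDiff I (I.prod 𝓘(ℝ, E →L[ℝ] E)) ∞
    (fun x ↦ Bundle.TotalSpace.mk' (E →L[ℝ] E)
      (E := fun x : M ↦ TangentSpace I x →L[ℝ] TangentSpace I x) x (toFun x))

end Fields

section Action

variable {E : Type*} [NormedAddCommGroup E] [NormedSpace ℝ E]
  {H : Type*} [TopologicalSpace H] {I : ModelWithCorners ℝ E H}
  {M : Type*} [TopologicalSpace M] [ChartedSpace H M] [IsManifold I ∞ M]

/-! ### Type `(1,0)` fields, connections, and condition `A(j, j₁)` -/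

/-- An almost complex structure acting on smooth vector fields, `(jX)_x = j_x X_x`. -/
def AlmostComplexStructure.onFields (j : AlmostComplexStructure I M) :
    VectorFields I M →ₗ[ℝ] VectorFields I M where
  toFun X := ⟨fun x ↦ j.toFun x (X x), j.smooth.clm_bundle_apply X.contMDiff⟩
  map_add' X Y := by ext x; exact map_add (j.toFun x) (X x) (Y x)
  map_smul' c X := by ext x; exact map_smul (j.toFun x) c (X x)

/-- `𝔛^{+,j}`: the space of complex vector fields of type `(1,0)` for `j`, that is,
the `i`-eigenspace of the complex linear extension of `j`. -/
def AlmostComplexStructure.typeOneZero (j : AlmostComplexStructure I M) :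
    Submodule ℂ (ComplexVectorFields I M) :=
  Module.End.eigenspace (j.onFields.baseChange ℂ) Complex.I

/-- A smooth linear connection as the real bilinear operator `(X, Y) ↦ ∇_X Y` on smooth vector
fields. (In Mathlib, `(∇_X Y)_x` is written `nabla Y x (X x)`.) -/
def covOnFields (nabla : CovariantDerivative I E (TangentSpace I : M → Type _))
    [hn : nabla.ContMDiffCovariantDerivative ∞] :
    LinearMap.BilinMap ℝ (VectorFields I M) (VectorFields I M) :=
  LinearMap.mk₂ ℝ
    (fun X Y ↦ ⟨fun x ↦ nabla Y x (X x), by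
      have h := hn.contMDiff.contMDiff (σ := Y) (by simpa using Y.contMDiff.contMDiffOn)
      rw [contMDiffOn_univ] at h
      exact h.clm_bundle_apply X.contMDiff⟩)
    (fun X X' Y ↦ by ext x; exact map_add (nabla Y x) (X x) (X' x))
    (fun c X Y ↦ by ext x; exact map_smul (nabla Y x) c (X x))
    (fun X Y Y' ↦ by
      ext x
      have h := nabla.isCovariantDerivativeOnUniv.add
        (Y.contMDiff.mdifferentiable (by simp) x) (Y'.contMDiff.mdifferentiable (by simp) x)
      exact congrArg (fun L ↦ L (X x)) h)
    (fun c X Y ↦ by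
      ext x
      have h := nabla.isCovariantDerivativeOnUniv.smul_const c
        (Y.contMDiff.mdifferentiable (by simp) x)
      exact congrArg (fun L ↦ L (X x)) h)

/-- Condition `A(j, j₁)`: `∇_Z W` has type `(1,0)` for `j₁` whenever the complex vector fields
`Z` and `W` have type `(1,0)` for `j` and `j₁`, respectively. Here `∇` is extended complex
bilinearly. -/
def ConditionA (nabla : CovariantDerivative I E (TangentSpace I : M → Type _))
    [nabla.ContMDiffCovariantDerivative ∞] (j j₁ : AlmostComplexStructure I M) : Prop :=
  ∀ Z ∈ j.typeOneZero, ∀ W ∈ j₁.typeOneZero,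
    LinearMap.BilinMap.baseChange ℂ (covOnFields nabla) Z W ∈ j₁.typeOneZero

/-- `j` is self-holomorphic if condition `A(j, j)` holds. -/
def IsSelfHolomorphic (nabla : CovariantDerivative I E (TangentSpace I : M → Type _))
    [nabla.ContMDiffCovariantDerivative ∞] (j : AlmostComplexStructure I M) : Prop :=
  ConditionA nabla j j

/-! ### The action of diffeomorphisms -/

/-- The differential of `g` at `g⁻¹(x)`, as a map `T_{g⁻¹(x)}M → T_{g(g⁻¹(x))}M = T_x M`. -/
def differential (g : M ≃ₘ⟮I, I⟯ M) (x : M) :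
    TangentSpace I (g.symm x) →L[ℝ] TangentSpace I x :=
  mfderiv I I g (g.symm x)

theorem mfderiv_symm_differential (g : M ≃ₘ⟮I, I⟯ M) (x : M) (v : TangentSpace I (g.symm x)) :
    mfderiv I I g.symm x (differential g x v) = v := by
  have h := mfderiv_comp (g.symm x) (g.symm.mdifferentiable (by simp) (g (g.symm x)))
    (g.mdifferentiable (by simp) (g.symm x))
  have h' : (g.symm ∘ g : M → M) = id := by ext y; simp
  rw [h', mfderiv_id, g.apply_symm_apply] at h
  exact (congrArg (fun L ↦ L v) h).symm

theorem differential_mfderiv_symm (g : M ≃ₘ⟮I, I⟯ M) (x : M) (v : TangentSpace I x) :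
    differential g x (mfderiv I I g.symm x v) = v := by
  have h := mfderiv_comp x (g.mdifferentiable (by simp) (g.symm x))
    (g.symm.mdifferentiable (by simp) x)
  have h' : (g ∘ g.symm : M → M) = id := by ext y; simp
  rw [h', mfderiv_id] at h
  exact (congrArg (fun L ↦ L v) h).symm

/-- The action of a diffeomorphism on vector fields, `(g·X)_x = dg(X_{g⁻¹(x)})`. -/
def pushField (g : M ≃ₘ⟮I, I⟯ M) : VectorFields I M →ₗ[ℝ] VectorFields I M where
  toFun X := ⟨fun x ↦ differential g x (X (g.symm x)), by
    have h := (g.contMDiff.contMDiff_tangentMap (m := ∞) (by simp)).comp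
      (X.contMDiff.comp g.symm.contMDiff)
    refine h.congr fun x ↦ ?_
    refine Bundle.TotalSpace.ext (g.apply_symm_apply x).symm HEq.rfl⟩
  map_add' X Y := by ext x; exact map_add (differential g x) _ _
  map_smul' c X := by ext x; exact map_smul (differential g x) c _

/-- The action of a diffeomorphism on connections,
`(g·∇)_X Y = g·(∇_{g⁻¹·X} (g⁻¹·Y))` for smooth vector fields `X`, `Y`. -/
def pushCov (g : M ≃ₘ⟮I, I⟯ M)
    (D : LinearMap.BilinMap ℝ (VectorFields I M) (VectorFields I M)) :
    LinearMap.BilinMap ℝ (VectorFields I M) (VectorFields I M) :=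
  (D.compl₁₂ (pushField g⁻¹) (pushField g⁻¹)).compr₂ (pushField g)

/-- `g·∇ = ∇`. -/
def PreservesCov (nabla : CovariantDerivative I E (TangentSpace I : M → Type _))
    [nabla.ContMDiffCovariantDerivative ∞] (g : M ≃ₘ⟮I, I⟯ M) : Prop :=
  pushCov g (covOnFields nabla) = covOnFields nabla

theorem pushField_one : pushField (1 : M ≃ₘ⟮I, I⟯ M) = LinearMap.id := by
  ext X x
  change mfderiv I I (id : M → M) x (X x) = X x
  rw [mfderiv_id]; rfl

theorem pushField_mul (g h : M ≃ₘ⟮I, I⟯ M) :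
    pushField (g * h) = pushField g ∘ₗ pushField h := by
  ext X x
  have hx : h (h.symm (g.symm x)) = g.symm x := h.apply_symm_apply _
  have e := mfderiv_comp (h.symm (g.symm x)) (g.mdifferentiable (by simp) _)
    (h.mdifferentiable (by simp) _) (I := I) (I' := I) (I'' := I)
  rw [hx] at e
  exact congrArg (fun L ↦ L (X (h.symm (g.symm x)))) e

theorem pushCov_one (D : LinearMap.BilinMap ℝ (VectorFields I M) (VectorFields I M)) :
    pushCov 1 D = D := by
  ext1 X; ext1 Y
  simp [pushCov, pushField_one]

theorem pushCov_mul (g h : M ≃ₘ⟮I, I⟯ M)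
    (D : LinearMap.BilinMap ℝ (VectorFields I M) (VectorFields I M)) :
    pushCov (g * h) D = pushCov g (pushCov h D) := by
  ext1 X; ext1 Y
  simp [pushCov, pushField_mul]

/-- `Diff(M, ∇)`: the isotropy subgroup of `∇` in `Diff(M)`. -/
def DiffPreserving (nabla : CovariantDerivative I E (TangentSpace I : M → Type _))
    [nabla.ContMDiffCovariantDerivative ∞] : Subgroup (M ≃ₘ⟮I, I⟯ M) where
  carrier := {g | PreservesCov nabla g}
  mul_mem' {g h} hg hh := by
    change pushCov (g * h) _ = _
    rw [pushCov_mul, show pushCov h _ = _ from hh]; exact hg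
  one_mem' := pushCov_one _
  inv_mem' {g} hg := by
    change pushCov g⁻¹ _ = _
    conv_lhs => rw [← show pushCov g _ = _ from hg]
    rw [← pushCov_mul, inv_mul_cancel, pushCov_one]

open ContinuousLinearMap in
theorem smooth_conj (g : M ≃ₘ⟮I, I⟯ M) (j : AlmostComplexStructure I M) :
    ContMDiff I (I.prod 𝓘(ℝ, E →L[ℝ] E)) ∞
      (fun x ↦ Bundle.TotalSpace.mk' (E →L[ℝ] E)
        (E := fun x : M ↦ TangentSpace I x →L[ℝ] TangentSpace I x) x
        ((differential g x).comp
          ((j.toFun (g.symm x)).comp (mfderiv I I g.symm x)))) := by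
  intro x₀
  rw [contMDiffAt_hom_bundle]
  refine ⟨contMDiffAt_id, ?_⟩
  have hA := (g.contMDiff.contMDiffAt (x := g.symm x₀)).mfderiv_const (m := ∞) (by simp)
  have hA' := hA.comp x₀ g.symm.contMDiff.contMDiffAt
  have hC := (g.symm.contMDiff.contMDiffAt (x := x₀)).mfderiv_const (m := ∞) (by simp)
  have hB := ((contMDiffAt_hom_bundle _).1 (j.smooth (g.symm x₀))).2
  have hB' := hB.comp x₀ g.symm.contMDiff.contMDiffAt
  refine ((hA'.clm_comp (hB'.clm_comp hC))).congr_of_eventuallyEq ?_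
  have hopen : ∀ᶠ x in nhds x₀, g.symm x ∈
      (trivializationAt E (TangentSpace I : M → Type _) (g.symm x₀)).baseSet :=
    g.symm.continuous.continuousAt.eventually_mem
      ((trivializationAt E (TangentSpace I : M → Type _) (g.symm x₀)).open_baseSet.mem_nhds
        (FiberBundle.mem_baseSet_trivializationAt' (g.symm x₀)))
  filter_upwards [hopen] with x hx
  ext v
  have hinv := fun w : TangentSpace I (g.symm x) ↦
    Bundle.Trivialization.symmL_continuousLinearMapAt (R := ℝ)
      (trivializationAt E (TangentSpace I : M → Type _) (g.symm x₀)) hx w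
  have hcast : ∀ (y : M) (w : E), y = x →
      (trivializationAt E (TangentSpace I : M → Type _) x₀).continuousLinearMapAt ℝ x w =
      (trivializationAt E (TangentSpace I : M → Type _) x₀).continuousLinearMapAt ℝ y w := by
    rintro y w rfl; rfl
  simp only [inTangentCoordinates, inCoordinates, Function.comp, id,
    ContinuousLinearMap.comp_apply, Diffeomorph.apply_symm_apply]
  erw [hinv, hinv]
  exact hcast _ _ (g.apply_symm_apply x)

/-- The action of a diffeomorphism on almost complex structures, `j ↦ dg ∘ j ∘ dg⁻¹`:
at the point `x` this is `dg_{g⁻¹(x)} ∘ j_{g⁻¹(x)} ∘ (dg⁻¹)_x`. -/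
def AlmostComplexStructure.conj (g : M ≃ₘ⟮I, I⟯ M) (j : AlmostComplexStructure I M) :
    AlmostComplexStructure I M where
  toFun x := (differential g x).comp
    ((j.toFun (g.symm x)).comp (mfderiv I I g.symm x))
  sq x v := by
    change differential g x (j.toFun _ (mfderiv I I g.symm x
      (differential g x (j.toFun _ (mfderiv I I g.symm x v))))) = -v
    rw [mfderiv_symm_differential, j.sq, map_neg, differential_mfderiv_symm]
  smooth := smooth_conj g j

/-! ### The moduli space -/

/-- The set of self-holomorphic almost complex structures on `M`. -/
abbrev SelfHolomorphicStructures (nabla : CovariantDerivative I E (TangentSpace I : M → Type _))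
    [nabla.ContMDiffCovariantDerivative ∞] :=
  {j : AlmostComplexStructure I M // IsSelfHolomorphic nabla j}

/-- Two self-holomorphic structures are identified if some `g ∈ Diff(M, ∇)` carries one to the
other. -/
def moduliRel (nabla : CovariantDerivative I E (TangentSpace I : M → Type _))
    [nabla.ContMDiffCovariantDerivative ∞] (j k : SelfHolomorphicStructures nabla) : Prop :=
  ∃ g ∈ DiffPreserving nabla, j.1.conj g = k.1

/-- `𝓜^∇`: self-holomorphic structures modulo `Diff(M, ∇)`. -/
def ModuliSpace (nabla : CovariantDerivative I E (TangentSpace I : M → Type _))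
    [nabla.ContMDiffCovariantDerivative ∞] :=
  Quot (moduliRel nabla)

/-- The class in `𝓜^∇` of a self-holomorphic structure. -/
def ModuliSpace.mk (nabla : CovariantDerivative I E (TangentSpace I : M → Type _))
    [nabla.ContMDiffCovariantDerivative ∞] (j : SelfHolomorphicStructures nabla) :
    ModuliSpace nabla :=
  Quot.mk _ j

end Action

end SelfHol

end

/-! A diffeomorphism `g` acts on `𝔛` by the automorphism `pushField g`, and `dg j dg⁻¹` acts on
fields as the conjugate of `j` by this automorphism (`onFields_conj`). Hence the complexified
`pushField g⁻¹` carries the fields of type `(1,0)` for `dg j dg⁻¹` to those of type `(1,0)` for `j`,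
and `pushField g` carries them back (`mem_typeOneZero_conj_iff`). Since `g·∇ = ∇` survives complex
bilinear extension (`baseChange_covOnFields`), `∇_Z W` is the push-forward of the derivative of the
pulled back fields, so condition `A(j, j₁)` is carried to `A(dg j dg⁻¹, dg j₁ dg⁻¹)`
(`ConditionA.conj`). The chain rule makes conjugation an action of `Diff(M)`, which restricts to an
action of `Diff(M, ∇)` on self-holomorphic structures. The relation defining the moduli space is the
orbit relation of this action, hence an equivalence relation, so that two classes agree exactly when
the structures lie in one orbit. -/

open scoped Manifold ContDiff Bundle TensorProduct

namespace SelfHol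

variable {E : Type*} [NormedAddCommGroup E] [NormedSpace ℝ E]
  {H : Type*} [TopologicalSpace H] {I : ModelWithCorners ℝ E H}
  {M : Type*} [TopologicalSpace M] [ChartedSpace H M] [IsManifold I ∞ M]

theorem pushField_comp_inv (g : M ≃ₘ⟮I, I⟯ M) :
    pushField g ∘ₗ pushField g⁻¹ = LinearMap.id := by
  rw [← pushField_mul, mul_inv_cancel, pushField_one]

theorem pushField_inv_comp (g : M ≃ₘ⟮I, I⟯ M) :
    pushField g⁻¹ ∘ₗ pushField g = LinearMap.id := by
  rw [← pushField_mul, inv_mul_cancel, pushField_one]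

/-- On vector fields, `dg ∘ j ∘ dg⁻¹` is the conjugate of `j` by the push-forward along `g`. -/
theorem onFields_conj (g : M ≃ₘ⟮I, I⟯ M) (j : AlmostComplexStructure I M) :
    (j.conj g).onFields = pushField g ∘ₗ j.onFields ∘ₗ pushField g⁻¹ := by
  ext X x
  -- The two sides agree up to transport along `g (g⁻¹ x) = x`.
  have h : ∀ y : M, y = x → (mfderiv I I g.symm y (X y) : E) = mfderiv I I g.symm x (X x) := by
    rintro y rfl; rfl
  exact (congrArg (fun v : E ↦ (differential g x (j.toFun (g.symm x) v) : E))
    (h _ (g.apply_symm_apply x))).symm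

theorem mem_typeOneZero_conj_iff (g : M ≃ₘ⟮I, I⟯ M) (j : AlmostComplexStructure I M)
    (Z : ComplexVectorFields I M) :
    Z ∈ (j.conj g).typeOneZero ↔ (pushField g⁻¹).baseChange ℂ Z ∈ j.typeOneZero := by
  have h₁ : ∀ W : ComplexVectorFields I M,
      (pushField g).baseChange ℂ ((pushField g⁻¹).baseChange ℂ W) = W := fun W ↦ by
    rw [← LinearMap.comp_apply, ← LinearMap.baseChange_comp, pushField_comp_inv,
      LinearMap.baseChange_id, LinearMap.id_apply]
  have h₂ : ∀ W : ComplexVectorFields I M,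
      (pushField g⁻¹).baseChange ℂ ((pushField g).baseChange ℂ W) = W := fun W ↦ by
    rw [← LinearMap.comp_apply, ← LinearMap.baseChange_comp, pushField_inv_comp,
      LinearMap.baseChange_id, LinearMap.id_apply]
  simp only [AlmostComplexStructure.typeOneZero, Module.End.mem_eigenspace_iff, onFields_conj,
    LinearMap.baseChange_comp, LinearMap.comp_apply]
  constructor
  · intro h
    rw [← map_smul, ← h, h₂]
  · intro h
    rw [h, map_smul, h₁]

/-- The complex bilinear extension of `g·∇ = ∇`, in the form of naturality of `∇` under `g⁻¹`. -/
theorem baseChange_covOnFields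
    {nabla : CovariantDerivative I E (TangentSpace I : M → Type _)}
    [nabla.ContMDiffCovariantDerivative ∞] {g : M ≃ₘ⟮I, I⟯ M} (hg : PreservesCov nabla g)
    (Z W : ComplexVectorFields I M) :
    (pushField g⁻¹).baseChange ℂ (LinearMap.BilinMap.baseChange ℂ (covOnFields nabla) Z W) =
      LinearMap.BilinMap.baseChange ℂ (covOnFields nabla)
        ((pushField g⁻¹).baseChange ℂ Z) ((pushField g⁻¹).baseChange ℂ W) := by
  have h (X Y : VectorFields I M) : pushField g⁻¹ (covOnFields nabla X Y) =
      covOnFields nabla (pushField g⁻¹ X) (pushField g⁻¹ Y) := by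
    have hXY : pushField g (covOnFields nabla (pushField g⁻¹ X) (pushField g⁻¹ Y)) =
        covOnFields nabla X Y := LinearMap.congr_fun₂ hg X Y
    rw [← hXY, ← LinearMap.comp_apply, pushField_inv_comp, LinearMap.id_apply]
  induction Z using TensorProduct.induction_on with
  | zero => simp
  | add Z Z' hZ hZ' => simp only [map_add, LinearMap.add_apply, hZ, hZ']
  | tmul c X =>
    induction W using TensorProduct.induction_on with
    | zero => simp
    | add W W' hW hW' => simp only [map_add, hW, hW']
    | tmul d Y => simp [h]

/-- A diffeomorphism preserving `∇` carries condition `A(j, j₁)` to the conjugate structures. -/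
theorem ConditionA.conj {nabla : CovariantDerivative I E (TangentSpace I : M → Type _)}
    [nabla.ContMDiffCovariantDerivative ∞] {j j₁ : AlmostComplexStructure I M}
    (h : ConditionA nabla j j₁) {g : M ≃ₘ⟮I, I⟯ M} (hg : PreservesCov nabla g) :
    ConditionA nabla (j.conj g) (j₁.conj g) := by
  intro Z hZ W hW
  rw [mem_typeOneZero_conj_iff] at hZ hW ⊢
  rw [baseChange_covOnFields hg]
  exact h _ hZ _ hW

theorem AlmostComplexStructure.conj_one (j : AlmostComplexStructure I M) :
    j.conj (1 : M ≃ₘ⟮I, I⟯ M) = j := by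
  ext x v
  change (mfderiv I I (id : M → M) x (j.toFun x (mfderiv I I (id : M → M) x v)) : E) = _
  rw [mfderiv_id]
  rfl

theorem AlmostComplexStructure.conj_mul (g h : M ≃ₘ⟮I, I⟯ M) (j : AlmostComplexStructure I M) :
    j.conj (g * h) = (j.conj h).conj g := by
  ext x v
  have hx : h (h.symm (g.symm x)) = g.symm x := h.apply_symm_apply _
  have e := mfderiv_comp (h.symm (g.symm x)) (g.mdifferentiable (by simp) _)
    (h.mdifferentiable (by simp) _) (I := I) (I' := I) (I'' := I)
  -- The definition of `conj` takes `dg` at `g⁻¹ x`, the chain rule at `h (h⁻¹ (g⁻¹ x))`.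
  rw [hx] at e
  have e' := mfderiv_comp x (h.symm.mdifferentiable (by simp) _)
    (g.symm.mdifferentiable (by simp) x) (I := I) (I' := I) (I'' := I)
  exact (congrArg (fun L ↦ L (j.toFun (h.symm (g.symm x))
      (mfderiv I I (h.symm ∘ g.symm) x v))) e).trans
    (congrArg (fun L : E →L[ℝ] E ↦ (mfderiv I I g (g.symm x)
      (mfderiv I I h (h.symm (g.symm x)) (j.toFun (h.symm (g.symm x)) (L v))) : E)) e')

/-- `Diff(M, ∇)` acts on the self-holomorphic structures by `g·j = dg ∘ j ∘ dg⁻¹`. -/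
@[reducible]
noncomputable def conjMulAction (nabla : CovariantDerivative I E (TangentSpace I : M → Type _))
    [nabla.ContMDiffCovariantDerivative ∞] :
    MulAction (DiffPreserving nabla) (SelfHolomorphicStructures nabla) where
  smul g j := ⟨j.1.conj g.1, ConditionA.conj j.2 g.2⟩
  one_smul j := Subtype.ext j.1.conj_one
  mul_smul g h j := Subtype.ext (j.1.conj_mul g.1 h.1)

theorem moduliRel_equivalence (nabla : CovariantDerivative I E (TangentSpace I : M → Type _))
    [nabla.ContMDiffCovariantDerivative ∞] : Equivalence (moduliRel nabla) where
  refl j := ⟨1, one_mem _, j.1.conj_one⟩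
  symm := by
    rintro j k ⟨g, hg, h⟩
    refine ⟨g⁻¹, inv_mem hg, ?_⟩
    rw [← h, ← AlmostComplexStructure.conj_mul, inv_mul_cancel, AlmostComplexStructure.conj_one]
  trans := by
    rintro j k l ⟨g, hg, h⟩ ⟨g', hg', h'⟩
    refine ⟨g' * g, mul_mem hg' hg, ?_⟩
    rw [AlmostComplexStructure.conj_mul, h, h']

end SelfHol

theorem mainTheorem3 {n : ℕ} {M : Type*} [TopologicalSpace M] [T2Space M] [ParacompactSpace M]
    [ChartedSpace (EuclideanSpace ℝ (Fin (2 * n))) M] [IsManifold (𝓡 (2 * n)) ∞ M]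
    (nabla : CovariantDerivative (𝓡 (2 * n)) (EuclideanSpace ℝ (Fin (2 * n)))
      (TangentSpace (𝓡 (2 * n)) : M → Type _))
    [nabla.ContMDiffCovariantDerivative ∞] :
    (∀ (j : SelfHol.AlmostComplexStructure (𝓡 (2 * n)) M) (g : M ≃ₘ⟮𝓡 (2 * n), 𝓡 (2 * n)⟯ M),
      SelfHol.IsSelfHolomorphic nabla j → SelfHol.PreservesCov nabla g →
        SelfHol.IsSelfHolomorphic nabla (j.conj g)) ∧
    ∃ _act : MulAction (SelfHol.DiffPreserving nabla) (SelfHol.SelfHolomorphicStructures nabla),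
      (∀ (g : SelfHol.DiffPreserving nabla) (j : SelfHol.SelfHolomorphicStructures nabla),
        (g • j).1 = j.1.conj g.1) ∧
      ∀ j k : SelfHol.SelfHolomorphicStructures nabla,
        SelfHol.ModuliSpace.mk nabla j = SelfHol.ModuliSpace.mk nabla k ↔
          ∃ g : SelfHol.DiffPreserving nabla, g • j = k := by
  refine ⟨fun j g hj hg ↦ SelfHol.ConditionA.conj hj hg,
    SelfHol.conjMulAction nabla, fun g j ↦ rfl, fun j k ↦ ?_⟩
  constructor
  · intro h
    obtain ⟨g, hg, e⟩ :=
      (SelfHol.moduliRel_equivalence nabla).eqvGen_iff.1 (Quot.eqvGen_exact h)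
    exact ⟨⟨g, hg⟩, Subtype.ext e⟩
  · rintro ⟨g, rfl⟩
    exact Quot.sound ⟨g.1, g.2, rfl⟩
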